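/- For $f\in\mathbb Z[x]$ let $H(f)$ be the largest absolute value of a coefficient of $f$, let $\Phi_n$ be the $n$-th cyclotomic polynomial, and for $n\ge 1$ let $B(n)=\max\{H(f): f\in\mathbb Z[x],\ f\mid x^n-1\}$. Let $p,q$ be distinct odd primes. Then $$B(pq^3)=\max\{\min\{p,q^3\},\ H(\Phi_p\Phi_q\Phi_{pq^2}\Phi_{q^3})\},$$ and explicitly $$B(pq^3)=\begin{cases}H(\Phi_p\Phi_q\Phi_{pq^2}\Phi_{q^3}) & \text{if } p<q,\\ \max\{p,\ H(\Phi_p\Phi_q\Phi_{pq^2}\Phi_{q^3})\} & \text{if } q<p<q^2,\\ p & \text{if } q^2<p<q^3,\\ q^3 & \text{if } p>q^3.\end{cases}$$ Moreover, there are unique non-negative integers $\rho,\sigma$ with $\rho p+\sigma q=(p-1)(q-1)$, and if $p<q$, then $$B(pq^3)=\max\{(\sigma+1)p,\ (p-\sigma-1)p\}.$$ Furthermore, if $p<q$, then $B(pq^b)>p$ for every integer $b>2$. -/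

import Mathlib

open Polynomial

namespace CyclotomicHeight

/-- The height of an integer polynomial: the largest absolute value of its coefficients
(and `0` for the zero polynomial). -/
def height (f : ℤ[X]) : ℕ :=
  f.support.sup fun i => (f.coeff i).natAbs

/-- The maximal height of a divisor of `x ^ n - 1` in `ℤ[x]`. For `n ≥ 1` the supremum is
an attained maximum, see `isGreatest_maxHeight`. -/
noncomputable def maxHeight (n : ℕ) : ℕ :=
  sSup {h : ℕ | ∃ f : ℤ[X], f ∣ X ^ n - 1 ∧ height f = h}

/-- The height agrees with Mathlib's (real valued) sup norm of a polynomial. -/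
theorem height_eq_supNorm (f : ℤ[X]) : (height f : ℝ) = f.supNorm := by
  apply le_antisymm
  · by_cases hf : f = 0
    · simp [hf, height]
    · obtain ⟨i, -, hi⟩ := Finset.exists_mem_eq_sup f.support
        (Polynomial.support_nonempty.2 hf) (fun i => (f.coeff i).natAbs)
      have h := f.le_supNorm i
      rw [height, hi, Nat.cast_natAbs, Int.cast_abs]
      simpa [Int.norm_eq_abs] using h
  · obtain ⟨i, hi⟩ := f.exists_eq_supNorm
    rw [hi, Int.norm_eq_abs, ← Int.cast_abs, ← Nat.cast_natAbs]
    norm_cast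
    by_cases h : f.coeff i = 0
    · simp [h]
    · exact Finset.le_sup (f := fun i => (f.coeff i).natAbs) (Polynomial.mem_support_iff.2 h)

/-- For `n ≥ 1`, `maxHeight n` is a genuine maximum. -/
theorem isGreatest_maxHeight {n : ℕ} (hn : n ≠ 0) :
    IsGreatest {h : ℕ | ∃ f : ℤ[X], f ∣ X ^ n - 1 ∧ height f = h} (maxHeight n) := by
  have hne : (X ^ n - 1 : ℤ[X]) ≠ 0 := X_pow_sub_C_ne_zero (Nat.pos_of_ne_zero hn) 1
  have hu : Finite (ℤ[X])ˣ := by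
    refine Finite.of_surjective (Units.map (C : ℤ →+* ℤ[X]).toMonoidHom) fun u => ?_
    obtain ⟨r, hr, hru⟩ := Polynomial.isUnit_iff.1 u.isUnit
    exact ⟨hr.unit, Units.ext hru⟩
  have hfu : Fintype (ℤ[X])ˣ := Fintype.ofFinite _
  have hfin : Finite {f : ℤ[X] // f ∣ X ^ n - 1} :=
    (UniqueFactorizationMonoid.fintypeSubtypeDvd _ hne).finite
  have hS : {h : ℕ | ∃ f : ℤ[X], f ∣ X ^ n - 1 ∧ height f = h}.Finite :=
    Set.Finite.image height (s := {f : ℤ[X] | f ∣ X ^ n - 1}) hfin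
  have hne' : {h : ℕ | ∃ f : ℤ[X], f ∣ X ^ n - 1 ∧ height f = h}.Nonempty :=
    ⟨_, 1, one_dvd _, rfl⟩
  exact ⟨Nat.sSup_mem hne' hS.bddAbove, fun h hh => le_csSup hS.bddAbove hh⟩

/-- The product `Φ_p Φ_q Φ_{p q^2} Φ_{q^3}` of cyclotomic polynomials. -/
noncomputable def specialDivisor (p q : ℕ) : ℤ[X] :=
  cyclotomic p ℤ * cyclotomic q ℤ * cyclotomic (p * q ^ 2) ℤ * cyclotomic (q ^ 3) ℤ

end CyclotomicHeight

/-! Write `E F = F (X ^ q)`, `geom k = 1 + X + ⋯ + X ^ (k - 1)` and `Q = Φ_{pq}`. The irreducible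
factors of `X ^ (p * q ^ 3) - 1` are `Φ_1`, `Φ_p = geom p`, and `geom q`, `Q` together with their
images under `E` and `E ∘ E`. So up to sign each divisor is `L * (M₁ * E (M₂ * E M₃))` with
`L ∣ X ^ p - 1` and `Mᵢ ∈ {1, geom q, Q, Q * geom q}` (`exists_levels_of_dvd`).

Everything is read off from residue classes modulo `q`. If `M₁ ≠ Q`, then `M₁` is `1` or a sum of `q`
monomials with distinct exponents modulo `q`, so the nonzero coefficients of `M₁ * E F` are
coefficients of `F`. If `M₁ = Q`, let `s * q + r * p = p * q + 1` with `0 < s < p`, `0 < r < q`; then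
`Q = geom r (X ^ p) * geom s (X ^ q) - X * geom (q - r) (X ^ p) * geom (p - s) (X ^ q)`, and the
exponents `p * i` with `i < r` and `1 + p * i` with `i < q - r` form a complete residue system, so
each coefficient of `Q * E F` is a sum of `s` consecutive coefficients of `F`, or minus a sum of
`p - s` consecutive ones (`IsInclExcl.zcoeff_mul_expand`). The same holds for `Q * E Q` with `q ^ 2`
in place of `q`.

*The bound `p`.* The polynomial `F = M₂ * E M₃` has its coefficients in `{-1, 0, 1}`, unless
`M₂ = Q` and `M₃ = geom q` (`IsLevel.flat_mul_expand`). When it has, each choice of `L` and `M₁`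
gives height at most `p` (`IsBase.coeffsIn_mul_of_flat`); the delicate product is `(X - 1) * Q * E F`,
treated in `IsInclExcl.coeffsIn_X_sub_one_mul`. In the exceptional case `M₁ * E F` has coefficients
in an interval of width `p`, and again the height is at most `p` with the single exception
`L = geom p`, `M₁ = geom q` (`IsBase.coeffsIn_mul_of_exceptional`), which is the special divisor.

*The bound `q ^ 3`.* The initial sums of coefficients of `Q` are `0` or `1`. It follows that the
product of those factors that are `Φ_p` or some `Φ_{p q ^ i}` is flat, and each `Φ_{q ^ i}` has only
`q` terms (`coeffsIn_cube`). For the same reason the special divisor has height at most `q ^ 2`,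
which settles `p > q ^ 2`.

*Attained values.* The divisor `geom p * geom (q ^ 3)` has height `min p (q ^ 3)`. For `p < q` the
special divisor has height `p * max s (p - s)` (`height_special_of_lt`), where `s = σ + 1`. -/

open Polynomial

namespace CyclotomicHeight

/-! ### Coefficients at integer indices -/

/-- The coefficient of an integer polynomial at an integer index, `0` at negative indices. -/
noncomputable def zcoeff (n : ℤ) : ℤ[X] →ₗ[ℤ] ℤ :=
  if 0 ≤ n then lcoeff ℤ n.toNat else 0

theorem zcoeff_natCast (n : ℕ) (f : ℤ[X]) : zcoeff n f = f.coeff n := by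
  simp [zcoeff]

theorem zcoeff_of_neg {n : ℤ} (hn : n < 0) (f : ℤ[X]) : zcoeff n f = 0 := by
  simp [zcoeff, not_le.2 hn]

theorem zcoeff_X_pow_mul (n : ℤ) (d : ℕ) (f : ℤ[X]) :
    zcoeff n (X ^ d * f) = zcoeff (n - d) f := by
  rcases lt_or_ge n 0 with hn | hn
  · rw [zcoeff_of_neg hn, zcoeff_of_neg (by omega)]
  · lift n to ℕ using hn
    rw [zcoeff_natCast, coeff_X_pow_mul']
    split_ifs with h
    · rw [← Nat.cast_sub h, zcoeff_natCast]
    · rw [zcoeff_of_neg (by omega)]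

theorem zcoeff_expand {m : ℕ} (hm : 0 < m) (n : ℤ) (f : ℤ[X]) :
    zcoeff n (expand ℤ m f) = if (m : ℤ) ∣ n then zcoeff (n / m) f else 0 := by
  rcases lt_or_ge n 0 with hn | hn
  · rw [zcoeff_of_neg hn, zcoeff_of_neg (Int.ediv_neg_of_neg_of_pos hn (by omega)), ite_self]
  · lift n to ℕ using hn
    rw [zcoeff_natCast, coeff_expand hm, ← Int.natCast_div, zcoeff_natCast]
    simp only [Int.natCast_dvd_natCast]

/-- The coefficients of `f` lie between `lo` and `hi`. -/
def CoeffsIn (f : ℤ[X]) (lo hi : ℤ) : Prop :=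
  ∀ n : ℤ, lo ≤ zcoeff n f ∧ zcoeff n f ≤ hi

namespace CoeffsIn

variable {f g : ℤ[X]} {lo hi lo' hi' : ℤ}

theorem lo_nonpos (h : CoeffsIn f lo hi) : lo ≤ 0 := by
  simpa [zcoeff_of_neg (show (-1 : ℤ) < 0 by norm_num)] using (h (-1)).1

theorem hi_nonneg (h : CoeffsIn f lo hi) : 0 ≤ hi := by
  simpa [zcoeff_of_neg (show (-1 : ℤ) < 0 by norm_num)] using (h (-1)).2

theorem mono (h : CoeffsIn f lo hi) (h1 : lo' ≤ lo) (h2 : hi ≤ hi') : CoeffsIn f lo' hi' :=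
  fun n => ⟨h1.trans (h n).1, (h n).2.trans h2⟩

/-- A binomial factor turns a coefficient range into its width. -/
theorem X_pow_sub_one_mul (h : CoeffsIn f lo hi) (d : ℕ) :
    CoeffsIn ((X ^ d - 1) * f) (lo - hi) (hi - lo) := by
  intro n
  have h1 := h n
  have h2 := h (n - d)
  rw [sub_mul, one_mul, map_sub, zcoeff_X_pow_mul]
  constructor <;> linarith

end CoeffsIn

theorem coeffsIn_zero : CoeffsIn 0 0 0 := fun n => by simp

theorem coeffsIn_one : CoeffsIn 1 0 1 := by
  intro n
  rcases lt_or_ge n 0 with hn | hn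
  · simp [zcoeff_of_neg hn]
  · lift n to ℕ using hn
    rw [zcoeff_natCast, coeff_one]
    split_ifs <;> simp

theorem height_le_iff {f : ℤ[X]} {k : ℕ} : height f ≤ k ↔ CoeffsIn f (-k) k := by
  rw [height, Finset.sup_le_iff]
  constructor
  · intro h n
    rcases lt_or_ge n 0 with hn | hn
    · simp [zcoeff_of_neg hn]
    · lift n to ℕ using hn
      rw [zcoeff_natCast]
      by_cases h0 : f.coeff n = 0
      · simp [h0]
      · have := h n (mem_support_iff.2 h0)
        omega
  · intro h n _
    have := h n
    rw [zcoeff_natCast] at this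
    omega

theorem natAbs_zcoeff_le_height (f : ℤ[X]) (n : ℤ) : (zcoeff n f).natAbs ≤ height f := by
  have := (height_le_iff (f := f)).1 le_rfl n
  omega

/-! ### Geometric sums and residue classes -/

/-- The geometric sum `1 + X + ⋯ + X ^ (k - 1)`. -/
noncomputable def geom (k : ℕ) : ℤ[X] := ∑ i ∈ Finset.range k, X ^ i

theorem geom_mul_X_sub_one (k : ℕ) : geom k * (X - 1) = X ^ k - 1 := geom_sum_mul X k

theorem geom_one : geom 1 = 1 := by simp [geom]

theorem geom_zero : geom 0 = 0 := by simp [geom]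

theorem geom_add (a b : ℕ) : geom (a + b) = geom a + X ^ a * geom b := by
  simp only [geom, Finset.sum_range_add, Finset.mul_sum, pow_add]

theorem expand_geom_mul (d k : ℕ) : expand ℤ d (geom k) * (X ^ d - 1) = X ^ (d * k) - 1 := by
  have := congrArg (expand ℤ d) (geom_mul_X_sub_one k)
  simpa [pow_mul] using this

theorem X_pow_sub_one_ne_zero {k : ℕ} (hk : k ≠ 0) : (X ^ k - 1 : ℤ[X]) ≠ 0 := by
  simpa using X_pow_sub_C_ne_zero (Nat.pos_of_ne_zero hk) (1 : ℤ)

theorem geom_mul (m k : ℕ) : geom (m * k) = geom m * expand ℤ m (geom k) := by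
  apply mul_right_cancel₀ (b := (X - 1 : ℤ[X])) (by simpa using X_pow_sub_one_ne_zero one_ne_zero)
  rw [geom_mul_X_sub_one, ← expand_geom_mul, ← geom_mul_X_sub_one m]
  ring

theorem zcoeff_expand_geom_mul (n : ℤ) (d k : ℕ) (f : ℤ[X]) :
    zcoeff n (expand ℤ d (geom k) * f) = ∑ i ∈ Finset.range k, zcoeff (n - d * i) f := by
  simp only [geom, map_sum, map_pow, expand_X, Finset.sum_mul, ← pow_mul]
  exact Finset.sum_congr rfl fun i _ => by rw [zcoeff_X_pow_mul]; push_cast; rfl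

theorem zcoeff_geom_mul (n : ℤ) (k : ℕ) (f : ℤ[X]) :
    zcoeff n (geom k * f) = ∑ i ∈ Finset.range k, zcoeff (n - i) f := by
  simpa using zcoeff_expand_geom_mul n 1 k f

theorem CoeffsIn.expand_geom_mul {f : ℤ[X]} {lo hi : ℤ} (h : CoeffsIn f lo hi) (d k : ℕ) :
    CoeffsIn (expand ℤ d (geom k) * f) (k * lo) (k * hi) := by
  intro n
  rw [zcoeff_expand_geom_mul]
  constructor
  · simpa using Finset.card_nsmul_le_sum (Finset.range k) _ lo fun i _ => (h (n - d * i)).1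
  · simpa using Finset.sum_le_card_nsmul (Finset.range k) _ hi fun i _ => (h (n - d * i)).2

theorem CoeffsIn.geom_mul {f : ℤ[X]} {lo hi : ℤ} (h : CoeffsIn f lo hi) (k : ℕ) :
    CoeffsIn (geom k * f) (k * lo) (k * hi) := by
  simpa using h.expand_geom_mul 1 k

/-- If the exponents `d * i` with `i < k` are distinct modulo `m`, then the coefficients of
`(∑ i < k, X ^ (d * i)) * U (X ^ m)` are coefficients of `U`. -/
theorem zcoeff_expand_geom_mul_expand {d m k : ℕ} (hm : 0 < m) (hdm : d.Coprime m) (hk : k ≤ m)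
    (U : ℤ[X]) (N : ℤ) {i : ℕ} (hi : i < k) :
    zcoeff (m * N + d * i) (expand ℤ d (geom k) * expand ℤ m U) = zcoeff N U := by
  rw [zcoeff_expand_geom_mul, Finset.sum_eq_single_of_mem i (Finset.mem_range.2 hi)]
  · rw [zcoeff_expand hm]
    simp [hm.ne']
  · intro j hj hji
    rw [Finset.mem_range] at hj
    rw [zcoeff_expand hm, if_neg]
    intro h
    have h1 : (m : ℤ) ∣ d * ((i : ℤ) - j) := by
      rw [show (d : ℤ) * ((i : ℤ) - j) = m * N + d * i - d * j - m * N by ring]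
      exact dvd_sub h (dvd_mul_right _ _)
    have h2 : (m : ℤ) ∣ (i : ℤ) - j :=
      IsCoprime.dvd_of_dvd_mul_left (Nat.isCoprime_iff_coprime.2 hdm.symm) h1
    have := Int.eq_zero_of_abs_lt_dvd h2 (by rw [abs_lt]; omega)
    omega

theorem zcoeff_expand_geom_mul_expand_of_not {d m k : ℕ} (hm : 0 < m) (U : ℤ[X]) (n : ℤ)
    (h : ∀ i < k, ¬ (m : ℤ) ∣ n - d * i) :
    zcoeff n (expand ℤ d (geom k) * expand ℤ m U) = 0 := by
  rw [zcoeff_expand_geom_mul]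
  refine Finset.sum_eq_zero fun i hi => ?_
  rw [zcoeff_expand hm, if_neg (h i (Finset.mem_range.1 hi))]

theorem exists_residue {d m : ℕ} (hm : 0 < m) (hdm : d.Coprime m) (n : ℤ) :
    ∃ i < m, ∃ N : ℤ, n = m * N + d * i := by
  obtain ⟨u, v, huv⟩ := Nat.isCoprime_iff_coprime.2 hdm
  have hm' : (0 : ℤ) < m := by exact_mod_cast hm
  refine ⟨((n * u) % m).toNat, ?_, n * v + d * ((n * u) / m), ?_⟩
  · have := Int.emod_lt_of_pos (n * u) hm'
    omega
  · rw [Int.toNat_of_nonneg (Int.emod_nonneg _ hm'.ne')]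
    have := Int.mul_ediv_add_emod (n * u) m
    linear_combination (-n) * huv - (d : ℤ) * this

/-- Two families of exponents, `d * i` with `i < a` and `c + d * i` with `i < b`, that together
form a complete residue system modulo `m`: each coefficient of the sum comes from just one of
`U` and `V`. -/
theorem zcoeff_residue_split {d m a b c : ℕ} (hm : 0 < m) (hdm : d.Coprime m) (hab : a + b = m)
    (hc : (m : ℤ) ∣ c - d * a) (U V : ℤ[X]) (n : ℤ) :
    (∃ i < a, ∃ N : ℤ, n = m * N + d * i ∧
      zcoeff n (expand ℤ d (geom a) * expand ℤ m U
        + X ^ c * (expand ℤ d (geom b) * expand ℤ m V)) = zcoeff N U) ∨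
    (∃ i < b, ∃ N : ℤ, n = m * N + (c + d * i) ∧
      zcoeff n (expand ℤ d (geom a) * expand ℤ m U
        + X ^ c * (expand ℤ d (geom b) * expand ℤ m V)) = zcoeff N V) := by
  have key : ∀ (i j : ℕ), i < m → j < m → i ≠ j → ¬ (m : ℤ) ∣ d * ((i : ℤ) - j) := by
    intro i j hi hj hij h
    have h2 : (m : ℤ) ∣ (i : ℤ) - j :=
      IsCoprime.dvd_of_dvd_mul_left (Nat.isCoprime_iff_coprime.2 hdm.symm) h
    have := Int.eq_zero_of_abs_lt_dvd h2 (by rw [abs_lt]; omega)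
    omega
  obtain ⟨e, he⟩ := hc
  obtain ⟨i, him, N, hn⟩ := exists_residue hm hdm n
  rcases lt_or_ge i a with hia | hia
  · left
    refine ⟨i, hia, N, hn, ?_⟩
    rw [map_add, zcoeff_X_pow_mul, zcoeff_expand_geom_mul_expand_of_not hm V, add_zero, hn,
      zcoeff_expand_geom_mul_expand hm hdm (by omega) U N hia]
    intro j hj h
    refine key i (a + j) him (by omega) (by omega) ?_
    obtain ⟨t, ht⟩ := h
    refine ⟨t + e - N, ?_⟩
    push_cast
    linear_combination ht + he - hn
  · right
    refine ⟨i - a, by omega, N - e, ?_, ?_⟩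
    · rw [hn, Nat.cast_sub hia]
      linear_combination -he
    · have h1 : n - c = m * (N - e) + d * ((i - a : ℕ) : ℤ) := by
        rw [hn, Nat.cast_sub hia]
        linear_combination -he
      rw [map_add, zcoeff_X_pow_mul, zcoeff_expand_geom_mul_expand_of_not hm U, zero_add, h1,
        zcoeff_expand_geom_mul_expand hm hdm (by omega) V _ (by omega)]
      intro j hj h
      refine key i j him (by omega) (by omega) ?_
      obtain ⟨t, ht⟩ := h
      refine ⟨t - N, ?_⟩
      linear_combination ht - hn

theorem CoeffsIn.residue_split {d m a b c : ℕ} (hm : 0 < m) (hdm : d.Coprime m)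
    (hab : a + b = m) (hc : (m : ℤ) ∣ c - d * a) {U V : ℤ[X]} {lo hi : ℤ}
    (hU : CoeffsIn U lo hi) (hV : CoeffsIn V lo hi) :
    CoeffsIn (expand ℤ d (geom a) * expand ℤ m U
      + X ^ c * (expand ℤ d (geom b) * expand ℤ m V)) lo hi := by
  intro n
  rcases zcoeff_residue_split hm hdm hab hc U V n with ⟨i, -, N, -, h⟩ | ⟨i, -, N, -, h⟩ <;> rw [h]
  exacts [hU N, hV N]

theorem CoeffsIn.expand_geom_mul_expand {d m k : ℕ} (hm : 0 < m) (hdm : d.Coprime m) (hk : k ≤ m)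
    {U : ℤ[X]} {lo hi : ℤ} (hU : CoeffsIn U lo hi) :
    CoeffsIn (expand ℤ d (geom k) * expand ℤ m U) lo hi := by
  have := CoeffsIn.residue_split (a := k) (b := m - k) (c := d * k) hm hdm (by omega) (by simp) hU
    (coeffsIn_zero.mono hU.lo_nonpos hU.hi_nonneg)
  simpa using this

theorem CoeffsIn.geom_mul_expand {m k : ℕ} (hm : 0 < m) (hk : k ≤ m)
    {U : ℤ[X]} {lo hi : ℤ} (hU : CoeffsIn U lo hi) :
    CoeffsIn (geom k * expand ℤ m U) lo hi := by
  simpa using hU.expand_geom_mul_expand (d := 1) hm (Nat.coprime_one_left m) hk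

theorem CoeffsIn.comp_X_pow {m : ℕ} (hm : 0 < m) {U : ℤ[X]} {lo hi : ℤ} (hU : CoeffsIn U lo hi) :
    CoeffsIn (expand ℤ m U) lo hi := by
  simpa [geom_one] using hU.geom_mul_expand (k := 1) hm hm

/-- If `m ∤ d`, then `X ^ d * U (X ^ m)` and `U (X ^ m)` have disjoint supports. -/
theorem CoeffsIn.X_pow_sub_one_mul_expand {m d : ℕ} (hm : 0 < m) (hd : ¬ m ∣ d) {U : ℤ[X]} {k : ℤ}
    (hU : CoeffsIn U (-k) k) : CoeffsIn ((X ^ d - 1) * expand ℤ m U) (-k) k := by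
  intro n
  have hk := hU.hi_nonneg
  have h1 := hU (n / m)
  have h2 := hU ((n - d) / m)
  rw [sub_mul, one_mul, map_sub, zcoeff_X_pow_mul, zcoeff_expand hm, zcoeff_expand hm]
  by_cases h3 : (m : ℤ) ∣ n
  · rw [if_pos h3, if_neg]
    · omega
    · intro h4
      have h5 := dvd_sub h3 h4
      rw [sub_sub_cancel] at h5
      exact hd (Int.natCast_dvd_natCast.1 h5)
  · rw [if_neg h3]
    split_ifs <;> omega

theorem coeffsIn_geom (k : ℕ) : CoeffsIn (geom k) 0 1 := by
  rcases Nat.eq_zero_or_pos k with rfl | hk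
  · exact (geom_zero ▸ coeffsIn_zero).mono le_rfl zero_le_one
  · simpa using coeffsIn_one.geom_mul_expand hk le_rfl

theorem zcoeff_geom {k : ℕ} {n : ℤ} (h0 : 0 ≤ n) (hn : n < k) : zcoeff n (geom k) = 1 := by
  lift n to ℕ using h0
  rw [zcoeff_natCast]
  simp only [geom, finsetSum_coeff, coeff_X_pow, Finset.sum_ite_eq, Finset.mem_range]
  rw [if_pos (by exact_mod_cast hn)]

theorem zcoeff_geom_mul_geom {a b : ℕ} (hab : a ≤ b) :
    zcoeff ((a : ℤ) - 1) (geom a * geom b) = a := by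
  rw [zcoeff_geom_mul, Finset.sum_congr rfl fun i hi => ?_, Finset.sum_const, Finset.card_range,
    nsmul_one]
  rw [Finset.mem_range] at hi
  exact zcoeff_geom (by omega) (by omega)

/-! ### Binary inclusion-exclusion polynomials -/

/-- `Q` is the quotient `(X ^ (p * m) - 1) * (X - 1) / ((X ^ p - 1) * (X ^ m - 1))`, stated without
division. For primes `p ≠ m` this is the cyclotomic polynomial `Φ_{pm}`. -/
def IsInclExcl (p m : ℕ) (Q : ℤ[X]) : Prop :=
  (X ^ p - 1) * (X ^ m - 1) * Q = (X ^ (p * m) - 1) * (X - 1)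

/-- `s` and `r` are positive with `s * m + r * p = p * m + 1`. For coprime `p, m > 1` there is just
one such pair, and `(r - 1) * p + (s - 1) * m = (p - 1) * (m - 1)`. -/
structure IsSplitting (p m s r : ℕ) : Prop where
  s_pos : 0 < s
  r_pos : 0 < r
  s_lt : s < p
  r_lt : r < m
  eq : s * m + r * p = p * m + 1

theorem exists_isSplitting {p m : ℕ} (hp : 1 < p) (hm : 1 < m) (h : p.Coprime m) :
    ∃ s r, IsSplitting p m s r := by
  obtain ⟨s, hs, hsm⟩ := Nat.exists_mul_mod_eq_one_of_coprime h.symm hp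
  have hs0 : 0 < s := by
    rcases Nat.eq_zero_or_pos s with rfl | h0
    · simp at hsm
    · exact h0
  have h1 := Nat.div_add_mod (m * s) p
  rw [hsm] at h1
  -- `m * s = p * t + 1` with `t < m`, and `r = m - t`
  have ht : m * s / p < m := by
    rw [Nat.div_lt_iff_lt_mul (by omega)]
    exact Nat.mul_lt_mul_of_pos_left hs (by omega)
  have ht0 : m * s / p ≠ 0 := by
    intro h0
    rw [h0, mul_zero, zero_add] at h1
    have := Nat.eq_one_of_mul_eq_one_right h1.symm
    omega
  refine ⟨s, m - m * s / p, hs0, Nat.sub_pos_of_lt ht, hs,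
    Nat.sub_lt (by omega) (Nat.pos_of_ne_zero ht0), ?_⟩
  zify [ht.le] at h1 ⊢
  linear_combination -h1

theorem isSplitting_of_eq {p m ρ σ : ℕ} (hp : 1 < p) (hm : 1 < m)
    (h : ρ * p + σ * m = (p - 1) * (m - 1)) : IsSplitting p m (σ + 1) (ρ + 1) := by
  have h' : (σ + 1) * m + (ρ + 1) * p = p * m + 1 := by
    zify [hp.le, hm.le] at h ⊢
    linear_combination h
  refine ⟨by omega, by omega, ?_, ?_, h'⟩
  · by_contra hc
    nlinarith [Nat.mul_le_mul_right m (not_lt.1 hc), Nat.zero_le (ρ * p)]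
  · by_contra hc
    nlinarith [Nat.mul_le_mul_right p (not_lt.1 hc), Nat.zero_le (σ * m)]

theorem IsSplitting.eq_of_eq {p m s r s' r' : ℕ} (h : IsSplitting p m s r)
    (h' : IsSplitting p m s' r') (hpm : p.Coprime m) : s = s' ∧ r = r' := by
  have e : (s : ℤ) * m + r * p = p * m + 1 := by exact_mod_cast h.eq
  have e' : (s' : ℤ) * m + r' * p = p * m + 1 := by exact_mod_cast h'.eq
  have hd : (p : ℤ) ∣ (s : ℤ) - s' :=
    IsCoprime.dvd_of_dvd_mul_right (Nat.isCoprime_iff_coprime.2 hpm)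
      ⟨(r' : ℤ) - r, by linear_combination e - e'⟩
  have h1 := h.s_lt
  have h2 := h'.s_lt
  have h0 := Int.eq_zero_of_abs_lt_dvd hd (by rw [abs_lt]; omega)
  have hs : s = s' := by omega
  subst hs
  refine ⟨rfl, ?_⟩
  have h3 : (r : ℤ) * p = r' * p := by linear_combination e - e'
  have h4 : 0 < p := by omega
  exact_mod_cast mul_right_cancel₀ (by exact_mod_cast h4.ne') h3

namespace IsInclExcl

variable {p m s r : ℕ} {Q F : ℤ[X]}

theorem of_mul_geom (h : Q * geom p = expand ℤ m (geom p)) : IsInclExcl p m Q := by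
  have h1 := geom_mul_X_sub_one p
  have h2 := expand_geom_mul m p
  unfold IsInclExcl
  rw [mul_comm p m, ← h2, ← h, ← h1]
  ring

theorem mul_geom (h : IsInclExcl p m Q) (hp : p ≠ 0) :
    Q * geom m = expand ℤ p (geom m) := by
  apply mul_right_cancel₀ (b := (X ^ p - 1 : ℤ[X]) * (X - 1))
    (mul_ne_zero (X_pow_sub_one_ne_zero hp) (by simpa using X_pow_sub_one_ne_zero one_ne_zero))
  have h1 := geom_mul_X_sub_one m
  have h2 := expand_geom_mul p m
  unfold IsInclExcl at h
  linear_combination (Q * (X ^ p - 1)) * h1 - (X - 1) * h2 + h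

theorem symm (h : IsInclExcl p m Q) : IsInclExcl m p Q := by
  unfold IsInclExcl at h ⊢
  rw [mul_comm m p, ← h]
  ring

/-- The explicit form of `Q`: a difference of two disjointly supported double geometric sums. -/
theorem eq_sub (h : IsInclExcl p m Q) (hs : IsSplitting p m s r) :
    Q = expand ℤ p (geom r) * expand ℤ m (geom s)
      - X * (expand ℤ p (geom (m - r)) * expand ℤ m (geom (p - s))) := by
  have hp0 : p ≠ 0 := by have := hs.s_lt; omega
  have hm0 : m ≠ 0 := by have := hs.r_lt; omega
  apply mul_left_cancel₀ (a := (X ^ p - 1 : ℤ[X]) * (X ^ m - 1))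
    (mul_ne_zero (X_pow_sub_one_ne_zero hp0) (X_pow_sub_one_ne_zero hm0))
  have e1 := expand_geom_mul p r
  have e2 := expand_geom_mul m s
  have e3 := expand_geom_mul p (m - r)
  have e4 := expand_geom_mul m (p - s)
  have x1 : (X : ℤ[X]) ^ (p * r) * X ^ (m * s) = X ^ (p * m) * X := by
    rw [← pow_add, ← pow_succ]; congr 1; linarith [hs.eq]
  have n3 : p * (m - r) + p * r = p * m := by rw [← mul_add, Nat.sub_add_cancel hs.r_lt.le]
  have n4 : m * (p - s) + m * s = p * m := by
    rw [← mul_add, Nat.sub_add_cancel hs.s_lt.le, mul_comm]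
  have x3 : (X : ℤ[X]) * X ^ (p * (m - r)) = X ^ (m * s) := by
    rw [← pow_succ']; congr 1; linarith [hs.eq]
  have x4 : (X : ℤ[X]) * X ^ (m * (p - s)) = X ^ (p * r) := by
    rw [← pow_succ']; congr 1; linarith [hs.eq]
  have x5 : (X : ℤ[X]) * (X ^ (p * (m - r)) * X ^ (m * (p - s))) = X ^ (p * m) := by
    rw [← pow_add, ← pow_succ']; congr 1; linarith [hs.eq]
  unfold IsInclExcl at h
  have l1 : (X ^ p - 1 : ℤ[X]) * (X ^ m - 1) * (expand ℤ p (geom r) * expand ℤ m (geom s)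
      - X * (expand ℤ p (geom (m - r)) * expand ℤ m (geom (p - s))))
      = (X ^ (p * r) - 1) * (X ^ (m * s) - 1)
        - X * ((X ^ (p * (m - r)) - 1) * (X ^ (m * (p - s)) - 1)) := by
    rw [← e1, ← e2, ← e3, ← e4]; ring
  rw [l1, h]
  linear_combination -x1 + x5 - x3 - x4

theorem mul_expand_eq (h : IsInclExcl p m Q) (hs : IsSplitting p m s r) :
    Q * expand ℤ m F = expand ℤ p (geom r) * expand ℤ m (geom s * F)
      + X ^ 1 * (expand ℤ p (geom (m - r)) * expand ℤ m (-(geom (p - s) * F))) := by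
  rw [h.eq_sub hs, map_neg, map_mul, map_mul]
  ring

/-- Each coefficient of `Q * F (X ^ m)` is a sum of `s` consecutive coefficients of `F`, or minus
a sum of `p - s` consecutive ones. -/
theorem zcoeff_mul_expand (h : IsInclExcl p m Q) (hs : IsSplitting p m s r) (hpm : p.Coprime m)
    (F : ℤ[X]) (n : ℤ) :
    (∃ i < r, ∃ N : ℤ, n = m * N + p * i ∧
      zcoeff n (Q * expand ℤ m F) = zcoeff N (geom s * F)) ∨
    (∃ i < m - r, ∃ N : ℤ, n = m * N + (1 + p * i) ∧
      zcoeff n (Q * expand ℤ m F) = -zcoeff N (geom (p - s) * F)) := by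
  have hr := hs.r_lt
  rw [h.mul_expand_eq hs]
  have e : (s : ℤ) * m + r * p = p * m + 1 := by exact_mod_cast hs.eq
  have := zcoeff_residue_split (a := r) (b := m - r) (c := 1) (by omega) hpm (by omega)
    ⟨(s : ℤ) - p, by push_cast; linear_combination -e⟩ (geom s * F) (-(geom (p - s) * F)) n
  simpa only [map_neg, Nat.cast_one] using this

/-- In the residue classes of `0` and `1` modulo `m` both kinds of window sums occur, with explicit
positions. -/
theorem zcoeff_mul_expand_at (h : IsInclExcl p m Q) (hs : IsSplitting p m s r)
    (hpm : p.Coprime m) (F : ℤ[X]) (N : ℤ) :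
    zcoeff (m * N) (Q * expand ℤ m F) = zcoeff N (geom s * F) ∧
    zcoeff (m * N + 1) (Q * expand ℤ m F) = -zcoeff N (geom (p - s) * F) := by
  have hr := hs.r_lt
  have hr0 := hs.r_pos
  have hm : 0 < m := by omega
  have e : (s : ℤ) * m + r * p = p * m + 1 := by exact_mod_cast hs.eq
  have key : ∀ j : ℤ, 0 < j → j < m → ¬ (m : ℤ) ∣ p * j := by
    intro j h0 hj hd
    have h1 := IsCoprime.dvd_of_dvd_mul_left (Nat.isCoprime_iff_coprime.2 hpm.symm) hd
    exact absurd (Int.le_of_dvd h0 h1) (not_le.2 hj)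
  rw [h.mul_expand_eq hs]
  constructor
  · have h1 := zcoeff_expand_geom_mul_expand hm hpm hr.le (geom s * F) N hr0
    rw [Nat.cast_zero, mul_zero, add_zero] at h1
    rw [map_add, h1, zcoeff_X_pow_mul, zcoeff_expand_geom_mul_expand_of_not hm, add_zero]
    rintro i hi ⟨t, ht⟩
    refine key (r + i) (by omega) (by omega) ⟨N + p - s - t, ?_⟩
    push_cast at ht
    linear_combination e - ht
  · have h1 := zcoeff_expand_geom_mul_expand (k := m - r) hm hpm (by omega)
      (-(geom (p - s) * F)) N (i := 0) (by omega)
    rw [Nat.cast_zero, mul_zero, add_zero] at h1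
    rw [map_add, zcoeff_X_pow_mul, Nat.cast_one, add_sub_cancel_right, h1, map_neg,
      zcoeff_expand_geom_mul_expand_of_not hm, zero_add]
    rintro i hi ⟨t, ht⟩
    refine key (r - i) (by omega) (by omega) ⟨t - N + p - s, ?_⟩
    linear_combination ht + e

theorem coeffsIn_mul_expand (h : IsInclExcl p m Q) (hs : IsSplitting p m s r) (hpm : p.Coprime m)
    {lo hi : ℤ} (h1 : CoeffsIn (geom s * F) lo hi)
    (h2 : CoeffsIn (geom (p - s) * F) (-hi) (-lo)) : CoeffsIn (Q * expand ℤ m F) lo hi := by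
  intro n
  rcases h.zcoeff_mul_expand hs hpm F n with ⟨i, -, N, -, e⟩ | ⟨i, -, N, -, e⟩ <;> rw [e]
  · exact h1 N
  · have := h2 N
    omega

/-- For `F` with coefficients `0` and `1`, the coefficients of `Q * F (X ^ m)` lie in an interval of
width `p`. -/
theorem coeffsIn_mul_expand_of_zero_one (h : IsInclExcl p m Q) (hs : IsSplitting p m s r)
    (hpm : p.Coprime m) (hF : CoeffsIn F 0 1) :
    CoeffsIn (Q * expand ℤ m F) (-(p - s)) s := by
  have hsp := hs.s_lt
  refine h.coeffsIn_mul_expand hs hpm ((hF.geom_mul s).mono ?_ ?_) ((hF.geom_mul (p - s)).mono ?_ ?_)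
    <;> push_cast [hsp.le] <;> omega

theorem coeffsIn_mul_expand_of_flat (h : IsInclExcl p m Q) (hs : IsSplitting p m s r)
    (hpm : p.Coprime m) (hF : CoeffsIn F (-1) 1) : CoeffsIn (Q * expand ℤ m F) (-p) p := by
  have hsp := hs.s_lt
  refine h.coeffsIn_mul_expand hs hpm ((hF.geom_mul s).mono ?_ ?_) ((hF.geom_mul (p - s)).mono ?_ ?_)
    <;> push_cast [hsp.le] <;> omega

end IsInclExcl

/-- Two windows of length `k` at distance `d` differ in at most `2 * min k d` terms. -/
theorem abs_zcoeff_geom_mul_sub_le {F : ℤ[X]} (hF : CoeffsIn F (-1) 1) (k : ℕ) (M N : ℤ) :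
    |zcoeff M (geom k * F) - zcoeff N (geom k * F)| ≤ 2 * k ∧
    |zcoeff M (geom k * F) - zcoeff N (geom k * F)| ≤ 2 * |M - N| := by
  constructor
  · have h1 := hF.geom_mul k M
    have h2 := hF.geom_mul k N
    rw [abs_le]
    constructor <;> linarith
  · wlog h : N ≤ M generalizing M N
    · rw [abs_sub_comm, abs_sub_comm M]
      exact this N M (le_of_not_ge h)
    · obtain ⟨d, hd⟩ := Int.eq_ofNat_of_zero_le (sub_nonneg.2 h)
      have e : (X ^ d - 1) * (geom k * F) = geom d * ((X ^ k - 1) * F) := by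
        rw [← geom_mul_X_sub_one, ← geom_mul_X_sub_one k]; ring
      have h1 := ((hF.X_pow_sub_one_mul k).geom_mul d) M
      rw [← e, sub_mul, one_mul, map_sub, zcoeff_X_pow_mul, show M - (d : ℤ) = N by omega] at h1
      rw [abs_of_nonneg (sub_nonneg.2 h), hd, abs_le]
      constructor <;> linarith

/-- Neighbouring coefficients of `Q * F (X ^ m)` with `F` flat differ by at most `p`. When both
are window sums of the same length `s` or `p - s`, the windows overlap in all but at most
`min s (p - s)` terms, and `2 * min s (p - s) ≤ p`. -/
theorem IsInclExcl.coeffsIn_X_sub_one_mul {p m s r : ℕ} {Q F : ℤ[X]} (h : IsInclExcl p m Q)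
    (hs : IsSplitting p m s r) (hpm : p.Coprime m) (hF : CoeffsIn F (-1) 1) :
    CoeffsIn ((X - 1) * (Q * expand ℤ m F)) (-p) p := by
  intro n
  have hsp := hs.s_lt
  have hs0 := hs.s_pos
  have hrm := hs.r_lt
  have hr0 := hs.r_pos
  have e : (s : ℤ) * m + r * p = p * m + 1 := by exact_mod_cast hs.eq
  rw [sub_mul, one_mul, map_sub, ← pow_one X, zcoeff_X_pow_mul, ← abs_le, Nat.cast_one]
  -- the distance of two windows of the same kind
  have dist : ∀ (i i' : ℕ) (N N' : ℤ) (R S : ℕ), i < R → i' < R →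
      (S : ℤ) * m + R * p ≤ p * m + 1 → (m : ℤ) * (N' - N) = p * ((i : ℤ) - i') - 1 →
      |N' - N| ≤ p - S := by
    intro i i' N N' R S hi hi' hRS hN
    have hm0 : (0 : ℤ) < m := by omega
    have hp2 : (2 : ℤ) ≤ p := by omega
    have b1 : (p : ℤ) * ((i : ℤ) - i') ≤ p * (R - 1) :=
      mul_le_mul_of_nonneg_left (by omega) (by omega)
    have b2 : (p : ℤ) * (-(R - 1)) ≤ p * ((i : ℤ) - i') :=
      mul_le_mul_of_nonneg_left (by omega) (by omega)
    rw [abs_le]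
    constructor
    · refine le_of_mul_le_mul_left (a := (m : ℤ)) ?_ hm0
      linarith
    · refine le_of_mul_le_mul_left (a := (m : ℤ)) ?_ hm0
      linarith
  rcases h.zcoeff_mul_expand hs hpm F (n - 1) with ⟨i', hi', N', e1', e'⟩ | ⟨i', hi', N', e1', e'⟩ <;>
  rcases h.zcoeff_mul_expand hs hpm F n with ⟨i, hi, N, e1, e2⟩ | ⟨i, hi, N, e1, e2⟩ <;>
  rw [e', e2]
  · obtain ⟨a1, a2⟩ := abs_zcoeff_geom_mul_sub_le hF s N' N
    have := dist i i' N N' r s hi hi' e.le (by linear_combination e1 - e1')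
    omega
  · have h1 := hF.geom_mul s N'
    have h2 := hF.geom_mul (p - s) N
    push_cast [hsp.le] at h2
    rw [abs_le]
    constructor <;> linarith
  · have h1 := hF.geom_mul s N
    have h2 := hF.geom_mul (p - s) N'
    push_cast [hsp.le] at h2
    rw [abs_le]
    constructor <;> linarith
  · obtain ⟨a1, a2⟩ := abs_zcoeff_geom_mul_sub_le hF (p - s) N N'
    have := dist i i' N N' (m - r) (p - s) hi hi' (by push_cast [hsp.le, hrm.le]; linarith)
      (by linear_combination e1 - e1')
    rw [abs_sub_comm] at this
    push_cast [hsp.le] at a1 this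
    rw [show -zcoeff N' (geom (p - s) * F) - -zcoeff N (geom (p - s) * F)
      = zcoeff N (geom (p - s) * F) - zcoeff N' (geom (p - s) * F) by ring]
    omega

/-! ### Bounded window sums -/

/-- All sums of consecutive coefficients of `F` are `-1`, `0` or `1`. -/
def HasFlatWindows (F : ℤ[X]) : Prop := ∀ k, CoeffsIn (geom k * F) (-1) 1

theorem HasFlatWindows.flat {F : ℤ[X]} (h : HasFlatWindows F) : CoeffsIn F (-1) 1 := by
  simpa [geom_one] using h 1

theorem hasFlatWindows_one : HasFlatWindows 1 := fun k => by
  simpa using (coeffsIn_geom k).mono (by norm_num) le_rfl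

/-- Windows of `F (X ^ m)` contain windows of `F`: with `k = m * k' + t`, the sum of `k` consecutive
coefficients is the sum of `k'` or `k' + 1` consecutive coefficients of `F`. -/
theorem HasFlatWindows.comp_X_pow {F : ℤ[X]} (h : HasFlatWindows F) {m : ℕ} (hm : 0 < m) :
    HasFlatWindows (expand ℤ m F) := by
  intro k
  have ht := Nat.mod_lt k hm
  have hk := Nat.div_add_mod k m
  generalize k / m = k' at hk
  generalize k % m = t at hk ht
  have e : geom k * expand ℤ m F = expand ℤ 1 (geom t) * expand ℤ m (geom (k' + 1) * F)
      + X ^ t * (expand ℤ 1 (geom (m - t)) * expand ℤ m (geom k' * F)) := by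
    have e1 : geom k = geom m * expand ℤ m (geom k') + X ^ (m * k') * geom t := by
      rw [← hk, geom_add, geom_mul]
    have e2 : geom m = geom t + X ^ t * geom (m - t) := by
      rw [← geom_add, Nat.add_sub_cancel' ht.le]
    have e3 : geom (k' + 1) = geom k' + X ^ k' := by rw [geom_add, geom_one, mul_one]
    rw [e1, e2, e3, expand_one, expand_one, map_mul, map_mul, map_add, map_pow, expand_X, ← pow_mul]
    ring
  rw [e]
  exact CoeffsIn.residue_split hm (Nat.coprime_one_left m) (by omega) (by simp) (h _) (h _)

/-- Since `Q * geom m = geom m (X ^ p)`, all initial sums of coefficients of `Q` are `0` or `1`. -/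
theorem IsInclExcl.hasFlatWindows {p m : ℕ} {Q : ℤ[X]} (h : IsInclExcl p m Q) (hp : 0 < p)
    (hm : 0 < m) (hpm : p.Coprime m) : HasFlatWindows Q := by
  intro k n
  rcases lt_or_ge n 0 with hn | hn
  · simp [zcoeff_of_neg hn]
  lift n to ℕ using hn
  -- `geom k * Q` agrees up to sign with `geom k * Q * (X ^ (m * (n + 1)) - 1)` at `n`
  have h1 : CoeffsIn (geom (m * (n + 1)) * Q) 0 1 := by
    rw [CyclotomicHeight.geom_mul, mul_right_comm, mul_comm _ Q, h.mul_geom hp.ne']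
    exact (coeffsIn_geom _).expand_geom_mul_expand hm hpm le_rfl
  have h2 := h1.X_pow_sub_one_mul k n
  have e : (X ^ k - 1) * (geom (m * (n + 1)) * Q) = (X ^ (m * (n + 1)) - 1) * (geom k * Q) := by
    rw [← geom_mul_X_sub_one k, ← geom_mul_X_sub_one (m * (n + 1))]; ring
  have hlt : (n : ℤ) - (m * (n + 1) : ℕ) < 0 := by
    have := Nat.le_mul_of_pos_left (n + 1) hm
    omega
  rw [e, sub_mul, one_mul, map_sub, zcoeff_X_pow_mul, zcoeff_of_neg hlt] at h2
  omega

theorem IsInclExcl.coeffsIn_mul_expand_of_windows {p m s r : ℕ} {Q F : ℤ[X]}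
    (h : IsInclExcl p m Q) (hs : IsSplitting p m s r) (hpm : p.Coprime m)
    (hF : HasFlatWindows F) : CoeffsIn (Q * expand ℤ m F) (-1) 1 :=
  h.coeffsIn_mul_expand hs hpm (hF _) (by simpa using hF (p - s))

/-! ### The four levels of a divisor -/

/-- The four divisors `1, Φ_q, Φ_{pq}, Φ_{pq} Φ_q` of `Φ_q Φ_{pq}`, where `geom q = Φ_q` and `Q`
stands for `Φ_{pq}`. A divisor of `X ^ (p * q ^ 3) - 1` is up to sign a product
`L * (M₁ * M₂ (X ^ q) * M₃ (X ^ (q ^ 2)))` with `L ∣ X ^ p - 1` and three such factors `Mᵢ`. -/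
def IsLevel (q : ℕ) (Q M : ℤ[X]) : Prop :=
  M = 1 ∨ M = geom q ∨ M = Q ∨ M = Q * geom q

/-- The four divisors `1, Φ_1, Φ_p, Φ_1 Φ_p` of `X ^ p - 1`, where `geom p = Φ_p`. -/
def IsBase (p : ℕ) (L : ℤ[X]) : Prop :=
  L = 1 ∨ L = X - 1 ∨ L = geom p ∨ L = (X - 1) * geom p

section

variable {p q : ℕ} {Q : ℤ[X]}

theorem IsInclExcl.mul_self_comp (h : IsInclExcl p q Q) (hq : q ≠ 0) :
    IsInclExcl p (q * q) (Q * expand ℤ q Q) := by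
  refine IsInclExcl.of_mul_geom ?_
  have e := h.symm.mul_geom hq
  rw [mul_right_comm, e, ← map_mul, mul_comm _ Q, e, expand_expand]

/-- The only level that can enlarge the range of coefficients is `Q` itself. -/
theorem IsLevel.coeffsIn_mul_expand (h : IsInclExcl p q Q) (hp : 0 < p) (hq : 0 < q)
    (hpq : p.Coprime q) {M F : ℤ[X]} (hM : IsLevel q Q M) (hMQ : M ≠ Q) {lo hi : ℤ}
    (hF : CoeffsIn F lo hi) : CoeffsIn (M * expand ℤ q F) lo hi := by
  rcases hM with rfl | rfl | rfl | rfl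
  · simpa using hF.comp_X_pow hq
  · exact hF.geom_mul_expand hq le_rfl
  · exact absurd rfl hMQ
  · rw [h.mul_geom hp.ne']
    exact hF.expand_geom_mul_expand hq hpq le_rfl

theorem IsLevel.flat (h : IsInclExcl p q Q) (hp : 0 < p) (hq : 0 < q) (hpq : p.Coprime q)
    {M : ℤ[X]} (hM : IsLevel q Q M) : CoeffsIn M (-1) 1 := by
  by_cases hMQ : M = Q
  · rw [hMQ]
    exact (h.hasFlatWindows hp hq hpq).flat
  · have := IsLevel.coeffsIn_mul_expand h hp hq hpq hM hMQ
      (coeffsIn_one.mono (lo' := -1) (by norm_num) le_rfl)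
    simpa using this

/-- Two levels give a flat polynomial, except for `Φ_{pq} * Φ_q (X ^ q) = Φ_{pq} Φ_{q ^ 2}`. -/
theorem IsLevel.flat_mul_expand (h : IsInclExcl p q Q) (hp : 1 < p) (hq : 1 < q)
    (hpq : p.Coprime q) {M N : ℤ[X]} (hM : IsLevel q Q M) (hN : IsLevel q Q N)
    (hMN : ¬ (M = Q ∧ N = geom q)) : CoeffsIn (M * expand ℤ q N) (-1) 1 := by
  have hp0 : 0 < p := by omega
  have hq0 : 0 < q := by omega
  by_cases hMQ : M = Q
  · subst hMQ
    obtain ⟨s, r, hs⟩ := exists_isSplitting hp hq hpq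
    rcases hN with rfl | rfl | rfl | rfl
    · exact h.coeffsIn_mul_expand_of_windows hs hpq hasFlatWindows_one
    · exact absurd ⟨rfl, rfl⟩ hMN
    · exact h.coeffsIn_mul_expand_of_windows hs hpq (h.hasFlatWindows hp0 hq0 hpq)
    · rw [h.mul_geom hp0.ne']
      have hsp := hs.s_lt
      refine h.coeffsIn_mul_expand hs hpq ?_ ?_
      · exact ((coeffsIn_geom q).geom_mul_expand hp0 hsp.le).mono (by norm_num) le_rfl
      · exact ((coeffsIn_geom q).geom_mul_expand hp0 (by omega)).mono (by norm_num) (by norm_num)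
  · exact IsLevel.coeffsIn_mul_expand h hp0 hq0 hpq hM hMQ (IsLevel.flat h hp0 hq0 hpq hN)

theorem IsBase.coeffsIn_mul_of_flat (h : IsInclExcl p q Q) (hp : 1 < p) (hq : 1 < q)
    (hpq : p.Coprime q) {L M F : ℤ[X]} (hL : IsBase p L) (hM : IsLevel q Q M)
    (hF : CoeffsIn F (-1) 1) : CoeffsIn (L * (M * expand ℤ q F)) (-p) p := by
  have hp0 : 0 < p := by omega
  have hq0 : 0 < q := by omega
  have hp2 : (2 : ℤ) ≤ p := by exact_mod_cast hp
  by_cases hMQ : M = Q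
  · subst hMQ
    obtain ⟨s, r, hs⟩ := exists_isSplitting hp hq hpq
    -- `Φ_p Φ_{pq} = Φ_p (X ^ q)`
    have e : geom p * (M * expand ℤ q F) = expand ℤ q (geom p * F) := by
      rw [map_mul, ← h.symm.mul_geom hq0.ne']; ring
    have hpF : CoeffsIn (geom p * F) (-p) p := (hF.geom_mul p).mono (by simp) (by simp)
    rcases hL with rfl | rfl | rfl | rfl
    · rw [one_mul]
      exact h.coeffsIn_mul_expand_of_flat hs hpq hF
    · exact h.coeffsIn_X_sub_one_mul hs hpq hF
    · rw [e]
      exact hpF.comp_X_pow hq0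
    · rw [mul_assoc, e]
      simpa using hpF.X_pow_sub_one_mul_expand (d := 1) hq0 (by simpa using hq.ne')
  · have hMF := IsLevel.coeffsIn_mul_expand h hp0 hq0 hpq hM hMQ hF
    rcases hL with rfl | rfl | rfl | rfl
    · rw [one_mul]
      exact hMF.mono (by omega) (by omega)
    · have := hMF.X_pow_sub_one_mul 1
      rw [pow_one] at this
      exact this.mono (by omega) (by omega)
    · exact (hMF.geom_mul p).mono (by simp) (by simp)
    · rw [mul_comm (X - 1), geom_mul_X_sub_one]
      exact (hMF.X_pow_sub_one_mul p).mono (by omega) (by omega)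

/-- The exceptional pair of levels: here the coefficients may be large, but they lie in an interval
of width `p`. This leaves room for a binomial factor. -/
theorem IsBase.coeffsIn_mul_of_exceptional (h : IsInclExcl p q Q) (hp : 2 < p) (hq : 1 < q)
    (hpq : p.Coprime q) {L M : ℤ[X]} (hL : IsBase p L) (hM : IsLevel q Q M)
    (hLM : ¬ (L = geom p ∧ M = geom q)) :
    CoeffsIn (L * (M * expand ℤ q (Q * expand ℤ q (geom q)))) (-p) p := by
  have hp0 : 0 < p := by omega
  have hq0 : 0 < q := by omega
  have eQ := h.symm.mul_geom hq0.ne'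
  -- `Φ_p Φ_{pq} Φ_{q ^ 2} = Φ_p (X ^ q) Φ_{q ^ 2}`
  have eG : geom p * (Q * expand ℤ q (geom q)) = expand ℤ q (geom p * geom q) := by
    rw [map_mul, ← eQ]; ring
  have hpψ : CoeffsIn (geom p * geom q) (-p) p :=
    ((coeffsIn_geom q).geom_mul p).mono (by simp) (by simp)
  -- the product of all factors but `L` has its coefficients in an interval of width `p`
  have hw : ∃ lo hi : ℤ, hi - lo = p ∧
      CoeffsIn (M * expand ℤ q (Q * expand ℤ q (geom q))) lo hi := by
    by_cases hMQ : M = Q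
    · obtain ⟨s, r, hs⟩ := exists_isSplitting (p := p) (by omega) (Nat.one_lt_mul_iff.2 ⟨hq0, hq0, .inl hq⟩)
        (hpq.mul_right hpq)
      refine ⟨-(p - s), s, by ring, ?_⟩
      have := (h.mul_self_comp hq0.ne').coeffsIn_mul_expand_of_zero_one hs (hpq.mul_right hpq)
        (coeffsIn_geom q)
      rwa [hMQ, map_mul, expand_expand, ← mul_assoc]
    · obtain ⟨s, r, hs⟩ := exists_isSplitting (by omega) hq hpq
      exact ⟨-(p - s), s, by ring, IsLevel.coeffsIn_mul_expand h hp0 hq0 hpq hM hMQ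
        (h.coeffsIn_mul_expand_of_zero_one hs hpq (coeffsIn_geom q))⟩
  obtain ⟨lo, hi, hlh, hw⟩ := hw
  have hlo := hw.lo_nonpos
  have hhi := hw.hi_nonneg
  rcases hL with rfl | rfl | rfl | rfl
  · rw [one_mul]
    exact hw.mono (by omega) (by omega)
  · have := hw.X_pow_sub_one_mul 1
    rw [pow_one] at this
    exact this.mono (by omega) (by omega)
  · rcases hM with rfl | rfl | rfl | rfl
    · rw [one_mul]
      rcases lt_or_ge p q with hlt | hge
      · -- `Φ_p` has degree less than `q`
        have hG : CoeffsIn (Q * expand ℤ q (geom q)) (-p) p := by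
          obtain ⟨s, r, hs⟩ := exists_isSplitting (by omega) hq hpq
          exact h.coeffsIn_mul_expand_of_flat hs hpq ((coeffsIn_geom q).mono (by norm_num) le_rfl)
        exact hG.geom_mul_expand hq0 hlt.le
      · -- `Φ_p Φ_{pq ^ 2}` is flat, and `Φ_{q ^ 3}` has `q ≤ p` terms
        have hf := ((h.hasFlatWindows hp0 hq0 hpq).comp_X_pow hq0) p
        have := hf.expand_geom_mul (q * q) q
        rw [map_mul, expand_expand]
        refine CoeffsIn.mono ?_ (lo := q * -1) (hi := q * 1) (by omega) (by omega)
        convert this using 1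
        ring
    · exact absurd ⟨rfl, rfl⟩ hLM
    · have e : geom p * (M * expand ℤ q (M * expand ℤ q (geom q)))
          = expand ℤ q (expand ℤ q (geom p * geom q)) := by
        rw [← eG, map_mul _ (geom p), ← eQ]; ring
      rw [e]
      exact (hpψ.comp_X_pow hq0).comp_X_pow hq0
    · have e : geom p * (Q * geom q * expand ℤ q (Q * expand ℤ q (geom q)))
          = geom q * expand ℤ q (expand ℤ q (geom p * geom q)) := by
        rw [← eG, map_mul _ (geom p), ← eQ]; ring
      rw [e]
      exact (hpψ.comp_X_pow hq0).geom_mul_expand hq0 le_rfl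
  · rw [mul_comm (X - 1), geom_mul_X_sub_one]
    exact (hw.X_pow_sub_one_mul p).mono (by omega) (by omega)

/-- Products of `Φ_p` and the `Φ_{p q ^ i}` are flat. -/
theorem flat_of_windows (h : IsInclExcl p q Q) (hp : 1 < p) (hq : 1 < q)
    (hpq : p.Coprime q) {L N F : ℤ[X]} (hL : L = 1 ∨ L = geom p) (hN : N = 1 ∨ N = Q)
    (hF : HasFlatWindows F) : CoeffsIn (L * (N * expand ℤ q F)) (-1) 1 := by
  have hq0 : 0 < q := by omega
  rcases hN with rfl | rfl
  · rw [one_mul]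
    rcases hL with rfl | rfl
    · rw [one_mul]
      exact (hF.comp_X_pow hq0).flat
    · exact hF.comp_X_pow hq0 p
  · rcases hL with rfl | rfl
    · obtain ⟨s, r, hs⟩ := exists_isSplitting hp hq hpq
      rw [one_mul]
      exact h.coeffsIn_mul_expand_of_windows hs hpq hF
    · have e : geom p * (N * expand ℤ q F) = expand ℤ q (geom p * F) := by
        rw [map_mul, ← h.symm.mul_geom hq0.ne']; ring
      rw [e]
      exact (hF p).comp_X_pow hq0

theorem IsInclExcl.hasFlatWindows_mul_expand (h : IsInclExcl p q Q) (hp : 1 < p) (hq : 1 < q)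
    (hpq : p.Coprime q) {M N : ℤ[X]} (hM : M = 1 ∨ M = Q) (hN : N = 1 ∨ N = Q) :
    HasFlatWindows (M * expand ℤ q N) := by
  have hp0 : 0 < p := by omega
  have hq0 : 0 < q := by omega
  have hQ := h.hasFlatWindows hp0 hq0 hpq
  rcases hM with rfl | rfl <;> rcases hN with rfl | rfl
  · simpa using hasFlatWindows_one
  · simpa using hQ.comp_X_pow hq0
  · simpa using hQ
  · exact (h.mul_self_comp hq0.ne').hasFlatWindows hp0 (Nat.mul_pos hq0 hq0) (hpq.mul_right hpq)

theorem IsLevel.exists_eq_mul {M : ℤ[X]} (hM : IsLevel q Q M) :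
    ∃ A N : ℤ[X], (A = 1 ∨ A = geom q) ∧ (N = 1 ∨ N = Q) ∧ M = A * N := by
  rcases hM with rfl | rfl | rfl | rfl
  · exact ⟨1, 1, by simp⟩
  · exact ⟨geom q, 1, by simp⟩
  · exact ⟨1, M, by simp⟩
  · exact ⟨geom q, Q, by simp [mul_comm]⟩

theorem IsBase.exists_eq_mul {L : ℤ[X]} (hL : IsBase p L) :
    ∃ A N : ℤ[X], (A = 1 ∨ A = X - 1) ∧ (N = 1 ∨ N = geom p) ∧ L = A * N := by
  rcases hL with rfl | rfl | rfl | rfl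
  · exact ⟨1, 1, by simp⟩
  · exact ⟨X - 1, 1, by simp⟩
  · exact ⟨1, geom p, by simp⟩
  · exact ⟨X - 1, geom p, by simp⟩

/-- The part of the divisor made of `Φ_p` and the `Φ_{p q ^ i}` is flat, and each `Φ_{q ^ i}` costs
at most a factor `q`. A factor `X - 1` costs `2 ≤ q`, so it replaces a missing `Φ_{q ^ i}`; if none
is missing, the product telescopes to `X ^ (q ^ 3) - 1`. -/
theorem coeffsIn_cube (h : IsInclExcl p q Q) (hp : 1 < p) (hq : 1 < q) (hpq : p.Coprime q)
    {L M₁ M₂ M₃ : ℤ[X]} (hL : IsBase p L) (h₁ : IsLevel q Q M₁) (h₂ : IsLevel q Q M₂)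
    (h₃ : IsLevel q Q M₃) :
    CoeffsIn (L * (M₁ * expand ℤ q (M₂ * expand ℤ q M₃))) (-(q ^ 3 : ℕ)) (q ^ 3 : ℕ) := by
  obtain ⟨A, B, hA, hB, rfl⟩ := hL.exists_eq_mul
  obtain ⟨A₁, N₁, hA₁, hN₁, rfl⟩ := h₁.exists_eq_mul
  obtain ⟨A₂, N₂, hA₂, hN₂, rfl⟩ := h₂.exists_eq_mul
  obtain ⟨A₃, N₃, hA₃, hN₃, rfl⟩ := h₃.exists_eq_mul
  have hW := flat_of_windows h hp hq hpq hB hN₁ (h.hasFlatWindows_mul_expand hp hq hpq hN₂ hN₃)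
  set W := B * (N₁ * expand ℤ q (N₂ * expand ℤ q N₃)) with hWdef
  have e : A * B * (A₁ * N₁ * expand ℤ q (A₂ * N₂ * expand ℤ q (A₃ * N₃)))
      = A * (expand ℤ 1 A₁ * (expand ℤ q A₂ * (expand ℤ (q * q) A₃ * W))) := by
    simp only [map_mul, expand_expand, hWdef, expand_one]
    ring
  rw [e]
  have step : ∀ {T f : ℤ[X]} (d k : ℕ), (T = 1 ∨ T = geom q) → CoeffsIn f (-k) k →
      CoeffsIn (expand ℤ d T * f) (-(q * k : ℕ)) (q * k : ℕ) := by
    rintro T f d k (rfl | rfl) hf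
    · have : k ≤ q * k := Nat.le_mul_of_pos_left k (by omega)
      rw [map_one, one_mul]
      exact hf.mono (by omega) (by omega)
    · refine (hf.expand_geom_mul d q).mono ?_ ?_ <;> push_cast <;> linarith
  have hW' : CoeffsIn W (-(1 : ℕ)) (1 : ℕ) := by simpa using hW
  have double : ∀ {f : ℤ[X]}, CoeffsIn f (-(q * (q * 1) : ℕ)) (q * (q * 1) : ℕ) →
      CoeffsIn ((X - 1) * f) (-(q ^ 3 : ℕ)) (q ^ 3 : ℕ) := by
    intro f hf
    have hq3 : 2 * (q * (q * 1)) ≤ q ^ 3 := by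
      rw [show q ^ 3 = q * (q * (q * 1)) by ring]
      exact Nat.mul_le_mul_right _ hq
    have := hf.X_pow_sub_one_mul 1
    rw [pow_one] at this
    exact this.mono (by omega) (by omega)
  rcases hA with rfl | rfl
  · rw [one_mul]
    have := step 1 _ hA₁ (step q _ hA₂ (step (q * q) 1 hA₃ hW'))
    rwa [show q * (q * (q * 1)) = q ^ 3 by ring] at this
  · rcases hA₁ with rfl | rfl
    · rw [map_one, one_mul]
      exact double (step q _ hA₂ (step (q * q) 1 hA₃ hW'))
    rcases hA₂ with rfl | rfl
    · rw [map_one, one_mul]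
      exact double (step 1 _ (.inr rfl) (step (q * q) 1 hA₃ hW'))
    rcases hA₃ with rfl | rfl
    · rw [map_one, one_mul]
      exact double (step 1 _ (.inr rfl) (step q 1 (.inr rfl) hW'))
    · have e1 : (X - 1) * (expand ℤ 1 (geom q) * (expand ℤ q (geom q) *
          (expand ℤ (q * q) (geom q) * W))) = (X ^ (q * q * q) - 1) * W := by
        rw [← expand_geom_mul (q * q) q, ← expand_geom_mul q q, ← geom_mul_X_sub_one q, expand_one]
        ring
      have hq3 : 2 ≤ q ^ 3 := le_trans hq (Nat.le_self_pow three_ne_zero q)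
      rw [e1]
      exact (hW.X_pow_sub_one_mul _).mono (by omega) (by omega)

/-! ### The special divisor -/

/-- `Φ_p Φ_q Φ_{p q ^ 2} Φ_{q ^ 3}` for `p < q`: as `Φ_p Φ_q` has a plateau of value `p`, the height
is `p` times that of `Φ_{pq} Φ_{q ^ 2}`, which takes the values `s` and `-(p - s)`. -/
theorem height_special_of_lt (h : IsInclExcl p q Q) (hpq : p.Coprime q) {s r : ℕ}
    (hs : IsSplitting p q s r) (hlt : p < q) :
    height (geom p * (geom q * expand ℤ q (Q * expand ℤ q (geom q)))) = p * max s (p - s) := by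
  have hsp := hs.s_lt
  have hs0 := hs.s_pos
  have hrq := hs.r_lt
  have hr0 := hs.r_pos
  have hp0 : 0 < p := by omega
  have hq0 : 0 < q := by omega
  set G := Q * expand ℤ q (geom q) with hG
  -- the plateau: the coefficient of the product at `q * N + (p - 1)` is `p` times that of `G` at `N`
  have plateau : ∀ N : ℤ, zcoeff (q * N + (p - 1)) (geom p * (geom q * expand ℤ q G))
      = p * zcoeff N G := by
    intro N
    rw [zcoeff_geom_mul, Finset.sum_congr rfl fun i hi => ?_, Finset.sum_const, Finset.card_range,
      nsmul_eq_mul]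
    have hi := Finset.mem_range.1 hi
    have := zcoeff_expand_geom_mul_expand (d := 1) (k := q) hq0 (Nat.coprime_one_left q) le_rfl G N
      (i := p - 1 - i) (by omega)
    rw [expand_one] at this
    rw [← this]
    congr 2
    push_cast [show i ≤ p - 1 by omega, show 1 ≤ p by omega]
    ring
  apply le_antisymm
  · rw [height_le_iff]
    have h1 := h.coeffsIn_mul_expand_of_zero_one hs hpq (coeffsIn_geom q)
    have h2 : CoeffsIn G (-(max s (p - s) : ℕ)) (max s (p - s) : ℕ) := h1.mono (by omega) (by omega)
    refine ((h2.geom_mul_expand hq0 le_rfl).geom_mul p).mono ?_ ?_ <;> push_cast <;> linarith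
  · have hpos : zcoeff (q * ((s : ℤ) - 1)) G = s := by
      rw [(h.zcoeff_mul_expand_at hs hpq (geom q) _).1]
      exact zcoeff_geom_mul_geom (by omega)
    have hneg : zcoeff (q * ((p - s : ℕ) - 1 : ℤ) + 1) G = -(p - s : ℕ) := by
      rw [(h.zcoeff_mul_expand_at hs hpq (geom q) _).2, zcoeff_geom_mul_geom (by omega)]
    have h1 := natAbs_zcoeff_le_height (geom p * (geom q * expand ℤ q G))
      (q * (q * ((s : ℤ) - 1)) + (p - 1))
    have h2 := natAbs_zcoeff_le_height (geom p * (geom q * expand ℤ q G))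
      (q * (q * ((p - s : ℕ) - 1 : ℤ) + 1) + (p - 1))
    rw [plateau, hpos, Int.natAbs_mul, Int.natAbs_natCast, Int.natAbs_natCast] at h1
    rw [plateau, hneg, Int.natAbs_mul, Int.natAbs_neg, Int.natAbs_natCast, Int.natAbs_natCast] at h2
    rcases max_choice s (p - s) with e | e <;> rw [e] <;> assumption

/-- The height of `Φ_p Φ_q Φ_{p q ^ 2} Φ_{q ^ 3}` is at most `q ^ 2`, as `Φ_p Φ_{p q ^ 2}` is flat. -/
theorem height_special_le (h : IsInclExcl p q Q) (hp : 0 < p) (hq : 0 < q) (hpq : p.Coprime q) :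
    height (geom p * (geom q * expand ℤ q (Q * expand ℤ q (geom q)))) ≤ q ^ 2 := by
  have hf := ((h.hasFlatWindows hp hq hpq).comp_X_pow hq) p
  have h1 := (hf.expand_geom_mul (q * q) q).geom_mul q
  rw [height_le_iff, map_mul, expand_expand]
  refine CoeffsIn.mono (lo := q * (q * -1)) (hi := q * (q * 1)) ?_ (by push_cast; linarith)
    (by push_cast; linarith)
  convert h1 using 1
  ring

end

/-! ### Divisors of `X ^ (p * q ^ 3) - 1` -/

theorem height_neg (f : ℤ[X]) : height (-f) = height f := by
  simp [height]

theorem exists_of_dvd_prime_mul {a f g : ℤ[X]} (ha : Prime a) (h : f ∣ a * g) :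
    ∃ M f', (M = 1 ∨ M = a) ∧ f = M * f' ∧ f' ∣ g := by
  obtain ⟨k, hk⟩ := h
  rcases ha.dvd_or_dvd ⟨g, hk.symm⟩ with ⟨f', rfl⟩ | ⟨k', rfl⟩
  · exact ⟨a, f', .inr rfl, rfl, k, mul_left_cancel₀ ha.ne_zero (by rw [hk]; ring)⟩
  · exact ⟨1, f, .inl rfl, (one_mul f).symm, k', mul_left_cancel₀ ha.ne_zero (by rw [hk]; ring)⟩

theorem exists_of_dvd_prime_mul_prime_mul {a b f g : ℤ[X]} (ha : Prime a) (hb : Prime b)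
    (h : f ∣ a * b * g) :
    ∃ M f', (M = 1 ∨ M = b ∨ M = a ∨ M = a * b) ∧ f = M * f' ∧ f' ∣ g := by
  rw [mul_assoc] at h
  obtain ⟨A, f₁, hA, rfl, h₁⟩ := exists_of_dvd_prime_mul ha h
  obtain ⟨B, f₂, hB, rfl, h₂⟩ := exists_of_dvd_prime_mul hb h₁
  refine ⟨A * B, f₂, ?_, (mul_assoc _ _ _).symm, h₂⟩
  rcases hA with rfl | rfl <;> rcases hB with rfl | rfl <;> simp

section

variable {p q : ℕ}

theorem cyclotomic_eq_geom (hp : p.Prime) : cyclotomic p ℤ = geom p := by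
  have := Fact.mk hp
  exact cyclotomic_prime ℤ p

theorem isInclExcl_cyclotomic (hp : p.Prime) (hq : q.Prime) (hpq : p ≠ q) :
    IsInclExcl p q (cyclotomic (p * q) ℤ) := by
  refine IsInclExcl.of_mul_geom ?_
  rw [← cyclotomic_eq_geom hp, cyclotomic_expand_eq_cyclotomic_mul hq]
  rwa [Nat.prime_dvd_prime_iff_eq hq hp, eq_comm]

theorem expand_cyclotomic (hq : q.Prime) {n : ℕ} (hn : q ∣ n) :
    expand ℤ q (cyclotomic n ℤ) = cyclotomic (n * q) ℤ :=
  cyclotomic_expand_eq_cyclotomic hq hn ℤ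

theorem specialDivisor_eq (hp : p.Prime) (hq : q.Prime) :
    specialDivisor p q = geom p * (geom q * expand ℤ q
      (cyclotomic (p * q) ℤ * expand ℤ q (geom q))) := by
  rw [map_mul, ← cyclotomic_eq_geom hp, ← cyclotomic_eq_geom hq,
    expand_cyclotomic hq (dvd_mul_left q p), expand_cyclotomic hq dvd_rfl,
    expand_cyclotomic hq (dvd_mul_left q q), specialDivisor, pow_three', pow_two]
  ring_nf

theorem prime_cyclotomic {n : ℕ} (hn : 0 < n) : Prime (cyclotomic n ℤ) :=
  (cyclotomic.irreducible hn).prime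

/-- The factorization of `X ^ (p * q ^ 3) - 1` with the factors grouped by the power of `q`. -/
theorem IsInclExcl.X_pow_sub_one_eq {Q : ℤ[X]} (h : IsInclExcl p q Q) (hp : p ≠ 0) :
    (X ^ (p * q ^ 3) - 1 : ℤ[X]) = (X - 1) * geom p * (Q * geom q *
      (expand ℤ q Q * expand ℤ q (geom q) *
        (expand ℤ (q * q) Q * expand ℤ (q * q) (geom q) * 1))) := by
  rw [← map_mul, ← map_mul, h.mul_geom hp, mul_comm (X - 1), geom_mul_X_sub_one, expand_expand,
    expand_expand, show p * q ^ 3 = q * q * p * q by ring, ← expand_geom_mul (q * q * p),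
    show q * q * p = q * p * q by ring, ← expand_geom_mul (q * p), mul_comm q p,
    ← expand_geom_mul p]
  ring

theorem IsLevel.exists_expand {Q M : ℤ[X]} (d : ℕ) (hM : M = 1 ∨ M = expand ℤ d (geom q) ∨
    M = expand ℤ d Q ∨ M = expand ℤ d Q * expand ℤ d (geom q)) :
    ∃ N, IsLevel q Q N ∧ M = expand ℤ d N := by
  rcases hM with h | h | h | h
  · exact ⟨1, .inl rfl, by rw [h, map_one]⟩
  · exact ⟨geom q, .inr (.inl rfl), h⟩
  · exact ⟨Q, .inr (.inr (.inl rfl)), h⟩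
  · exact ⟨Q * geom q, .inr (.inr (.inr rfl)), by rw [h, map_mul]⟩

theorem prime_expand_cyclotomic (hq : q.Prime) {n : ℕ} (hn0 : 0 < n) (hn : q ∣ n) :
    Prime (expand ℤ q (cyclotomic n ℤ)) := by
  rw [expand_cyclotomic hq hn]
  exact prime_cyclotomic (Nat.mul_pos hn0 hq.pos)

theorem prime_expand_expand_cyclotomic (hq : q.Prime) {n : ℕ} (hn0 : 0 < n) (hn : q ∣ n) :
    Prime (expand ℤ (q * q) (cyclotomic n ℤ)) := by
  rw [← expand_expand, expand_cyclotomic hq hn]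
  exact prime_expand_cyclotomic hq (Nat.mul_pos hn0 hq.pos) (dvd_mul_left q n)

theorem exists_levels_of_dvd (hp : p.Prime) (hq : q.Prime) (hpq : p ≠ q) {f : ℤ[X]}
    (hf : f ∣ X ^ (p * q ^ 3) - 1) :
    ∃ L M₁ M₂ M₃ u : ℤ[X], IsBase p L ∧ IsLevel q (cyclotomic (p * q) ℤ) M₁ ∧
      IsLevel q (cyclotomic (p * q) ℤ) M₂ ∧ IsLevel q (cyclotomic (p * q) ℤ) M₃ ∧
      (u = 1 ∨ u = -1) ∧ f = u * (L * (M₁ * expand ℤ q (M₂ * expand ℤ q M₃))) := by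
  have hpq0 : 0 < p * q := Nat.mul_pos hp.pos hq.pos
  have hqd : q ∣ p * q := dvd_mul_left q p
  have p1 : Prime (geom p) := by
    rw [← cyclotomic_eq_geom hp]
    exact prime_cyclotomic hp.pos
  have p2 : Prime (X - 1 : ℤ[X]) := by
    rw [← cyclotomic_one ℤ]
    exact prime_cyclotomic one_pos
  have p3 : Prime (cyclotomic (p * q) ℤ) := prime_cyclotomic hpq0
  have p5 : Prime (expand ℤ q (cyclotomic (p * q) ℤ)) := prime_expand_cyclotomic hq hpq0 hqd
  have p7 : Prime (expand ℤ (q * q) (cyclotomic (p * q) ℤ)) :=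
    prime_expand_expand_cyclotomic hq hpq0 hqd
  have p4 := prime_cyclotomic hq.pos
  have p6 := prime_expand_cyclotomic hq hq.pos dvd_rfl
  have p8 := prime_expand_expand_cyclotomic hq hq.pos dvd_rfl
  rw [cyclotomic_eq_geom hq] at p4 p6 p8
  rw [(isInclExcl_cyclotomic hp hq hpq).X_pow_sub_one_eq hp.ne_zero] at hf
  generalize cyclotomic (p * q) ℤ = Q at *
  obtain ⟨L, f₁, hL, rfl, hf₁⟩ := exists_of_dvd_prime_mul_prime_mul p2 p1 hf
  obtain ⟨M₁, f₂, hM₁, rfl, hf₂⟩ := exists_of_dvd_prime_mul_prime_mul p3 p4 hf₁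
  obtain ⟨M₂, f₃, hM₂, rfl, hf₃⟩ := exists_of_dvd_prime_mul_prime_mul p5 p6 hf₂
  obtain ⟨M₃, u, hM₃, rfl, hu⟩ := exists_of_dvd_prime_mul_prime_mul p7 p8 hf₃
  obtain ⟨N₂, hN₂, rfl⟩ := IsLevel.exists_expand q hM₂
  obtain ⟨N₃, hN₃, rfl⟩ := IsLevel.exists_expand (q * q) hM₃
  refine ⟨L, M₁, N₂, N₃, u, ?_, hM₁, hN₂, hN₃, ?_, ?_⟩
  · rcases hL with h | h | h | h
    exacts [.inl h, .inr (.inr (.inl h)), .inr (.inl h), .inr (.inr (.inr h))]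
  · obtain ⟨c, hc, rfl⟩ := Polynomial.isUnit_iff.1 (isUnit_of_dvd_one hu)
    rcases Int.isUnit_iff.1 hc with rfl | rfl <;> simp
  · rw [map_mul, expand_expand]
    ring

/-- All divisors of `X ^ (p * q ^ 3) - 1` except `± specialDivisor p q` have height at most
`min p (q ^ 3)`. -/
theorem height_le_or_eq_of_dvd (hp : p.Prime) (hq : q.Prime) (hp2 : 2 < p) (hpq : p ≠ q)
    {f : ℤ[X]} (hf : f ∣ X ^ (p * q ^ 3) - 1) :
    height f ≤ min p (q ^ 3) ∨ height f = height (specialDivisor p q) := by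
  obtain ⟨L, M₁, M₂, M₃, u, hL, h₁, h₂, h₃, hu, rfl⟩ := exists_levels_of_dvd hp hq hpq hf
  have h := isInclExcl_cyclotomic hp hq hpq
  have hc := (Nat.coprime_primes hp hq).2 hpq
  rw [specialDivisor_eq hp hq]
  generalize cyclotomic (p * q) ℤ = Q at h h₁ h₂ h₃ ⊢
  have hu' : ∀ g : ℤ[X], height (u * g) = height g := by
    intro g
    rcases hu with rfl | rfl
    · rw [one_mul]
    · rw [neg_one_mul, height_neg]
  rw [hu', le_min_iff, height_le_iff, height_le_iff]
  have hq3 := coeffsIn_cube h hp.one_lt hq.one_lt hc hL h₁ h₂ h₃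
  by_cases hM : M₂ = Q ∧ M₃ = geom q
  · obtain ⟨rfl, rfl⟩ := hM
    by_cases hLM : L = geom p ∧ M₁ = geom q
    · obtain ⟨rfl, rfl⟩ := hLM
      exact .inr rfl
    · exact .inl ⟨hL.coeffsIn_mul_of_exceptional h hp2 hq.one_lt hc h₁ hLM, hq3⟩
  · exact .inl ⟨hL.coeffsIn_mul_of_flat h hp.one_lt hq.one_lt hc h₁
      (h₂.flat_mul_expand h hp.one_lt hq.one_lt hc h₃ hM), hq3⟩

theorem le_maxHeight {n : ℕ} (hn : n ≠ 0) {f : ℤ[X]} (hf : f ∣ X ^ n - 1) :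
    height f ≤ maxHeight n :=
  (isGreatest_maxHeight hn).2 ⟨f, hf, rfl⟩

theorem maxHeight_le_of_dvd {m n : ℕ} (hn : n ≠ 0) (h : m ∣ n) : maxHeight m ≤ maxHeight n := by
  have hm : m ≠ 0 := fun h0 => hn (by simpa [h0] using h)
  obtain ⟨f, hf, he⟩ := (isGreatest_maxHeight hm).1
  rw [← he]
  obtain ⟨k, rfl⟩ := h
  refine le_maxHeight hn (hf.trans ?_)
  simpa [pow_mul] using sub_dvd_pow_sub_pow (X ^ m : ℤ[X]) 1 k

theorem specialDivisor_dvd (hp : p.Prime) (hq : q.Prime) (hpq : p ≠ q) :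
    specialDivisor p q ∣ X ^ (p * q ^ 3) - 1 := by
  rw [specialDivisor_eq hp hq, (isInclExcl_cyclotomic hp hq hpq).X_pow_sub_one_eq hp.ne_zero]
  generalize cyclotomic (p * q) ℤ = Q
  refine ⟨(X - 1) * Q * expand ℤ q (geom q) * expand ℤ (q * q) Q, ?_⟩
  rw [map_mul, expand_expand]
  ring

/-- The bound is attained at `Φ_p Φ_q Φ_{q ^ 2} Φ_{q ^ 3}`, that is `geom p * geom (q ^ 3)`. -/
theorem min_le_maxHeight (hp : p.Prime) (hq : q.Prime) (hpq : p ≠ q) :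
    min p (q ^ 3) ≤ maxHeight (p * q ^ 3) := by
  have hdvd : geom p * geom (q ^ 3) ∣ X ^ (p * q ^ 3) - 1 := by
    have e : geom (q ^ 3) = geom q * (expand ℤ q (geom q) * expand ℤ (q * q) (geom q)) := by
      rw [pow_three, geom_mul, geom_mul, map_mul, expand_expand]
    rw [(isInclExcl_cyclotomic hp hq hpq).X_pow_sub_one_eq hp.ne_zero, e]
    generalize cyclotomic (p * q) ℤ = Q
    refine ⟨(X - 1) * Q * expand ℤ q Q * expand ℤ (q * q) Q, ?_⟩
    ring
  have hn : p * q ^ 3 ≠ 0 := mul_ne_zero hp.ne_zero (pow_ne_zero 3 hq.ne_zero)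
  refine le_trans ?_ (le_maxHeight hn hdvd)
  rcases le_total p (q ^ 3) with h | h
  · have := natAbs_zcoeff_le_height (geom p * geom (q ^ 3)) (p - 1)
    rw [zcoeff_geom_mul_geom h, Int.natAbs_natCast] at this
    exact (min_le_left _ _).trans this
  · have := natAbs_zcoeff_le_height (geom (q ^ 3) * geom p) ((q ^ 3 : ℕ) - 1)
    rw [zcoeff_geom_mul_geom h, Int.natAbs_natCast, mul_comm (geom _)] at this
    exact (min_le_right _ _).trans this

theorem maxHeight_eq (hp : p.Prime) (hq : q.Prime) (hp2 : 2 < p) (hpq : p ≠ q) :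
    maxHeight (p * q ^ 3) = max (min p (q ^ 3)) (height (specialDivisor p q)) := by
  have hn : p * q ^ 3 ≠ 0 := mul_ne_zero hp.ne_zero (pow_ne_zero 3 hq.ne_zero)
  apply le_antisymm
  · obtain ⟨f, hf, he⟩ := (isGreatest_maxHeight hn).1
    rw [← he, le_max_iff]
    exact (height_le_or_eq_of_dvd hp hq hp2 hpq hf).imp_right le_of_eq
  · exact max_le (min_le_maxHeight hp hq hpq) (le_maxHeight hn (specialDivisor_dvd hp hq hpq))

/-- The larger of `s` and `p - s` is at least `2`, so for `p < q` the special divisor beats `p`. -/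
theorem lt_height_specialDivisor (hp : p.Prime) (hq : q.Prime) (hp2 : 2 < p) (hlt : p < q) :
    p < height (specialDivisor p q) := by
  have hc := (Nat.coprime_primes hp hq).2 hlt.ne
  obtain ⟨s, r, hs⟩ := exists_isSplitting hp.one_lt hq.one_lt hc
  rw [specialDivisor_eq hp hq,
    height_special_of_lt (isInclExcl_cyclotomic hp hq hlt.ne) hc hs hlt]
  exact lt_mul_of_one_lt_right hp.pos (by omega)

end

end CyclotomicHeight

open CyclotomicHeight in
theorem theorem1p6 (p q : ℕ) (hp : p.Prime) (hq : q.Prime) (hp2 : Odd p) (hq2 : Odd q)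
    (hpq : p ≠ q) :
    -- the formula valid for all distinct odd primes
    maxHeight (p * q ^ 3) = max (min p (q ^ 3)) (height (specialDivisor p q)) ∧
    -- its explicit form in the four ranges
    (p < q → maxHeight (p * q ^ 3) = height (specialDivisor p q)) ∧
    (q < p → p < q ^ 2 → maxHeight (p * q ^ 3) = max p (height (specialDivisor p q))) ∧
    (q ^ 2 < p → p < q ^ 3 → maxHeight (p * q ^ 3) = p) ∧
    (q ^ 3 < p → maxHeight (p * q ^ 3) = q ^ 3) ∧
    -- `ρ` and `σ` exist and are unique, and give the value for `p < q`
    (∃! rs : ℕ × ℕ, rs.1 * p + rs.2 * q = (p - 1) * (q - 1)) ∧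
    (∀ ρ σ : ℕ, ρ * p + σ * q = (p - 1) * (q - 1) → p < q →
      (maxHeight (p * q ^ 3) : ℤ) =
        max (((σ : ℤ) + 1) * p) (((p : ℤ) - σ - 1) * p)) ∧
    -- the lower bound for all exponents greater than two
    (p < q → ∀ b : ℕ, 2 < b → p < maxHeight (p * q ^ b)) := by
  have hp3 : 2 < p := by
    have := hp.two_le
    obtain ⟨k, hk⟩ := hp2
    omega
  have hc := (Nat.coprime_primes hp hq).2 hpq
  have hQ := isInclExcl_cyclotomic hp hq hpq
  have hmain := maxHeight_eq hp hq hp3 hpq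
  have hsq : height (specialDivisor p q) ≤ q ^ 2 := by
    rw [specialDivisor_eq hp hq]
    exact height_special_le hQ hp.pos hq.pos hc
  have h23 : q ^ 2 ≤ q ^ 3 := Nat.pow_le_pow_right hq.pos (by norm_num)
  have hlt : p < q → maxHeight (p * q ^ 3) = height (specialDivisor p q) := fun h => by
    rw [hmain]
    exact max_eq_right ((min_le_left _ _).trans (lt_height_specialDivisor hp hq hp3 h).le)
  refine ⟨hmain, hlt, fun _ h => ?_, fun h h' => ?_, fun h => ?_, ?_, fun ρ σ h hpq' => ?_,
    fun h b hb => ?_⟩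
  · rw [hmain, min_eq_left (h.le.trans h23)]
  · rw [hmain, min_eq_left h'.le]
    exact max_eq_left (hsq.trans h.le)
  · rw [hmain, min_eq_right h.le]
    exact max_eq_left (hsq.trans h23)
  · obtain ⟨s, r, hs⟩ := exists_isSplitting hp.one_lt hq.one_lt hc
    have hs0 := hs.s_pos
    have hr0 := hs.r_pos
    refine ⟨(r - 1, s - 1), ?_, ?_⟩
    · have := hs.eq
      zify [hs0, hr0, hp.one_lt.le, hq.one_lt.le] at this ⊢
      linear_combination this
    · rintro ⟨ρ, σ⟩ h
      obtain ⟨h1, h2⟩ := (isSplitting_of_eq hp.one_lt hq.one_lt h).eq_of_eq hs hc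
      simp only [Prod.mk.injEq]
      omega
  · have hs := isSplitting_of_eq hp.one_lt hq.one_lt h
    have hsp := hs.s_lt
    rw [hlt hpq', specialDivisor_eq hp hq, height_special_of_lt hQ hc hs hpq', mul_comm]
    push_cast [hsp.le]
    rw [max_mul_of_nonneg _ _ (Int.natCast_nonneg p), sub_add_eq_sub_sub]
  · have h3 := lt_height_specialDivisor hp hq hp3 h
    rw [← hlt h] at h3
    exact h3.trans_le (maxHeight_le_of_dvd (mul_ne_zero hp.ne_zero (pow_ne_zero b hq.ne_zero))
      (mul_dvd_mul_left p (pow_dvd_pow q hb)))
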